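/- Let $n\in\mathbb N$ and let $H,K$ be $n\times n$ complex Hermitian matrices. For Hermitian matrices write $A\le B$ if $B-A$ is positive semidefinite, and for positive semidefinite $A,B$ write $A\preceq_{ols}B$ (Olson order) if $A^r\le B^r$ for every real $r\ge 1$. For positive definite $A,B$ and $\alpha\in[0,1]$ let $A\,\sharp_\alpha B=A^{1/2}\bigl(A^{-1/2}BA^{-1/2}\bigr)^{\alpha}A^{1/2}$ be the $\alpha$-weighted geometric mean. For a Hermitian matrix $A$ let $\lambda_1(A)\ge\lambda_2(A)\ge\dots\ge\lambda_n(A)$ be its eigenvalues, counted with multiplicity, in decreasing order. For $x>0$ let $$S(x)=\frac{(x-1)\,x^{1/(x-1)}}{e\log x}\quad(x\ne 1),\qquad S(1)=1$$ be Specht's ratio. Suppose that $e^s e^H\preceq_{ols}e^K\preceq_{ols}e^t e^H$ for some real scalars $s\le t$, and let $\alpha\in[0,1]$. Then for every $p>0$ and every $k=1,2,\dots,n$, $$\lambda_k\bigl(e^{(1-\alpha)H+\alpha K}\bigr)\le\bigl(\max\{S(e^{sp}),S(e^{tp})\}\bigr)^{1/p}\,\lambda_k\bigl(e^{pH}\,\sharp_\alpha\,e^{pK}\bigr)^{1/p}.$$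 -/

import Mathlib

open scoped MatrixOrder ComplexOrder

noncomputable section

/-- Specht's ratio `S(t)` (for `t > 0`). -/
def spechtRatio (t : ℝ) : ℝ :=
  if t = 1 then 1 else (t - 1) * t ^ (1 / (t - 1)) / (Real.exp 1 * Real.log t)

/-- The Olson order: `A` and `B` are positive semidefinite and `A ^ r ≤ B ^ r` in the Loewner order
for all real `r ≥ 1`; the powers are those of the continuous functional calculus. -/
def OlsonLE {ι : Type*} [Fintype ι] [DecidableEq ι] (A B : Matrix ι ι ℂ) : Prop :=
  A.PosSemidef ∧ B.PosSemidef ∧ ∀ r : ℝ, 1 ≤ r → A ^ r ≤ B ^ r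

/-- The `α`-weighted geometric mean of positive definite matrices,
`A ♯_α B = A^{1/2} (A^{-1/2} B A^{-1/2})^α A^{1/2}`. -/
def geomMean {ι : Type*} [Fintype ι] [DecidableEq ι] (α : ℝ) (A B : Matrix ι ι ℂ) :
    Matrix ι ι ℂ :=
  A ^ (1 / 2 : ℝ) * (A ^ (-(1 / 2) : ℝ) * B * A ^ (-(1 / 2) : ℝ)) ^ α * A ^ (1 / 2 : ℝ)

/-- The geometric mean is Hermitian, so that its ordered eigenvalues are defined. -/
theorem isHermitian_geomMean {ι : Type*} [Fintype ι] [DecidableEq ι] (α : ℝ)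
    (A B : Matrix ι ι ℂ) : (geomMean α A B).IsHermitian := by
  have h1 : (A ^ (1 / 2 : ℝ)).IsHermitian :=
    (Matrix.nonneg_iff_posSemidef.1 (CFC.rpow_nonneg (a := A))).isHermitian
  have h2 : ((A ^ (-(1 / 2) : ℝ) * B * A ^ (-(1 / 2) : ℝ)) ^ α).IsHermitian :=
    (Matrix.nonneg_iff_posSemidef.1 CFC.rpow_nonneg).isHermitian
  have h := Matrix.isHermitian_mul_mul_conjTranspose (A ^ (1 / 2 : ℝ)) h2
  rwa [h1.eq] at h

/-- `e^{(1-α)H + αK}` is Hermitian, so that its ordered eigenvalues are defined. -/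
theorem isHermitian_exp_add {ι : Type*} [Fintype ι] [DecidableEq ι] {H K : Matrix ι ι ℂ}
    (hH : H.IsHermitian) (hK : K.IsHermitian) (α : ℝ) :
    (NormedSpace.exp ((1 - α) • H + α • K)).IsHermitian :=
  Matrix.IsHermitian.exp ((hH.smul (IsSelfAdjoint.all _)).add (hK.smul (IsSelfAdjoint.all _)))

end

/-! The Olson order, with Loewner–Heinz when `p < 1`, gives `e^{sp} e^{pH} ≤ e^{pK} ≤ e^{tp}
e^{pH}`. Under such bounds Specht's reverse Young inequality lifts to operators: the arithmetic mean
of `e^{pH}` and `e^{pK}` is at most `M` times `G`, with `M` the larger Specht ratio and `G` their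
geometric mean. As `log` is operator concave and operator monotone, `p((1-α)H + αK) ≤ log(M G)`. The
exponential is not operator monotone, so Weyl's principle is applied to this inequality first, and
the eigenvalues are exponentiated afterwards. -/

/-! ### Ordered eigenvalues. -/

open scoped InnerProductSpace in
/-- **Weyl's monotonicity principle**: the ordered eigenvalues of a symmetric operator are monotone
in the operator. -/
theorem LinearMap.IsSymmetric.eigenvalues_le_eigenvalues {𝕜 E : Type*} [RCLike 𝕜]
    [NormedAddCommGroup E] [InnerProductSpace 𝕜 E] [FiniteDimensional 𝕜 E] {n : ℕ}
    (hn : Module.finrank 𝕜 E = n) {T S : E →ₗ[𝕜] E} (hT : T.IsSymmetric) (hS : S.IsSymmetric)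
    (h : ∀ x, RCLike.re ⟪x, T x⟫_𝕜 ≤ RCLike.re ⟪x, S x⟫_𝕜) (k : Fin n) :
    hT.eigenvalues hn k ≤ hS.eigenvalues hn k := by
  have expand : ∀ {R : E →ₗ[𝕜] E} (hR : R.IsSymmetric) (x : E),
      RCLike.re ⟪x, R x⟫_𝕜 =
        ∑ i, hR.eigenvalues hn i * ‖⟪hR.eigenvectorBasis hn i, x⟫_𝕜‖ ^ 2 := by
    intro R hR x
    rw [← (hR.eigenvectorBasis hn).sum_inner_mul_inner, map_sum]
    refine Finset.sum_congr rfl fun i _ => ?_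
    rw [← hR, hR.apply_eigenvectorBasis, inner_smul_left, RCLike.conj_ofReal, mul_left_comm,
      RCLike.re_ofReal_mul, ← inner_conj_symm x, RCLike.conj_mul, ← RCLike.ofReal_pow,
      RCLike.ofReal_re]
  have expand_norm : ∀ {R : E →ₗ[𝕜] E} (hR : R.IsSymmetric) (x : E),
      ∑ i, ‖⟪hR.eigenvectorBasis hn i, x⟫_𝕜‖ ^ 2 = ‖x‖ ^ 2 :=
    fun hR x => (hR.eigenvectorBasis hn).sum_sq_norm_inner_right x
  -- Only `n - 1` functionals, so some nonzero `x` is orthogonal to the eigenvectors of `T` after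
  -- `k` and to those of `S` before `k`.
  let F : E →ₗ[𝕜] ({i : Fin n // i ≠ k} → 𝕜) := LinearMap.pi fun i =>
    if k < i.1 then innerₛₗ 𝕜 (hT.eigenvectorBasis hn i.1)
    else innerₛₗ 𝕜 (hS.eigenvectorBasis hn i.1)
  have hF : LinearMap.ker F ≠ ⊥ := by
    refine F.ker_ne_bot_of_finrank_lt ?_
    have := k.pos
    simp only [Module.finrank_fintype_fun_eq_card, hn, ne_eq, Fintype.card_subtype_compl,
      Fintype.card_fin, Fintype.card_subtype_eq]
    omega
  obtain ⟨x, hx, hx0⟩ := (Submodule.ne_bot_iff _).1 hF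
  have hT0 : ∀ i, k < i → ⟪hT.eigenvectorBasis hn i, x⟫_𝕜 = 0 := by
    intro i hi
    have := congrFun (LinearMap.mem_ker.1 hx) ⟨i, hi.ne'⟩
    simpa [F, hi] using this
  have hS0 : ∀ i, i < k → ⟪hS.eigenvectorBasis hn i, x⟫_𝕜 = 0 := by
    intro i hi
    have := congrFun (LinearMap.mem_ker.1 hx) ⟨i, hi.ne⟩
    simpa [F, hi.not_gt] using this
  have lower : hT.eigenvalues hn k * ‖x‖ ^ 2 ≤ RCLike.re ⟪x, T x⟫_𝕜 := by
    rw [expand hT, ← expand_norm hT, Finset.mul_sum]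
    refine Finset.sum_le_sum fun i _ => ?_
    rcases lt_or_ge k i with hi | hi
    · simp [hT0 i hi]
    · exact mul_le_mul_of_nonneg_right (hT.eigenvalues_antitone hn hi) (by positivity)
  have upper : RCLike.re ⟪x, S x⟫_𝕜 ≤ hS.eigenvalues hn k * ‖x‖ ^ 2 := by
    rw [expand hS, ← expand_norm hS, Finset.mul_sum]
    refine Finset.sum_le_sum fun i _ => ?_
    rcases lt_or_ge i k with hi | hi
    · simp [hS0 i hi]
    · exact mul_le_mul_of_nonneg_right (hS.eigenvalues_antitone hn hi) (by positivity)
  exact le_of_mul_le_mul_right (lower.trans ((h x).trans upper)) (by positivity)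

/-- The ordered eigenvalues of a Hermitian matrix are monotone for the Loewner order. -/
theorem Matrix.IsHermitian.eigenvalues₀_le_eigenvalues₀ {𝕜 ι : Type*} [RCLike 𝕜] [Fintype ι]
    [DecidableEq ι] {A B : Matrix ι ι 𝕜} (hA : A.IsHermitian) (hB : B.IsHermitian) (h : A ≤ B)
    (k : Fin (Fintype.card ι)) : hA.eigenvalues₀ k ≤ hB.eigenvalues₀ k := by
  refine LinearMap.IsSymmetric.eigenvalues_le_eigenvalues _ _ _ (fun x => ?_) k
  have := (Matrix.isPositive_toEuclideanLin_iff.2 (Matrix.le_iff.1 h)).re_inner_nonneg_right x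
  simpa [inner_sub_right] using this

/-- The functional calculus of a monotone function acts on the ordered eigenvalues. -/
theorem Matrix.IsHermitian.eigenvalues₀_eq_of_eq_cfc {𝕜 ι : Type*} [RCLike 𝕜] [Fintype ι]
    [DecidableEq ι] {A B : Matrix ι ι 𝕜} (hA : A.IsHermitian) (hB : B.IsHermitian) {f : ℝ → ℝ}
    (hf : Monotone f) (h : B = cfc f A) (k : Fin (Fintype.card ι)) :
    hB.eigenvalues₀ k = f (hA.eigenvalues₀ k) := by
  have hroots : B.charpoly.roots =
      Multiset.map (RCLike.ofReal ∘ f ∘ hA.eigenvalues₀) Finset.univ.val := by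
    rw [h, hA.charpoly_cfc_eq, Polynomial.roots_prod _ _
      (by simp [Finset.prod_ne_zero_iff, Polynomial.X_sub_C_ne_zero])]
    -- `eigenvalues` reindexes `eigenvalues₀` by `ι`, so the two are compared as multisets.
    have key : Multiset.map hA.eigenvalues Finset.univ.val =
        Multiset.map hA.eigenvalues₀ Finset.univ.val := by
      have := hA.roots_charpoly_eq_eigenvalues.symm.trans hA.roots_charpoly_eq_eigenvalues₀
      simpa [Multiset.map_map, Function.comp_def] using congrArg (Multiset.map RCLike.re) this
    have := congrArg (Multiset.map fun x : ℝ => ((f x : ℝ) : 𝕜)) key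
    simpa [Multiset.map_map, Function.comp_def] using this
  have hsort := hB.sort_roots_charpoly_eq_eigenvalues₀
  rw [hroots] at hsort
  have hlist : List.ofFn (f ∘ hA.eigenvalues₀) = List.ofFn hB.eigenvalues₀ := by
    rw [← hsort]
    simp_rw [Fin.univ_val_map, Multiset.map_coe, List.map_ofFn, Function.comp_def,
      RCLike.ofReal_re, Multiset.coe_sort]
    symm
    apply List.mergeSort_of_pairwise
    simp_rw [decide_eq_true_eq, ← List.sortedGE_iff_pairwise]
    exact (hf.comp_antitone hA.eigenvalues₀_antitone).sortedGE_ofFn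
  exact (congrFun (List.ofFn_inj.1 hlist) k).symm

/-! ### Scalar inequalities for Specht's ratio. -/

/-- **Specht's reverse Young inequality**. -/
theorem arith_mean_le_spechtRatio_mul_rpow {x : ℝ} (hx : 0 < x) (v : ℝ) :
    (1 - v) + v * x ≤ spechtRatio x * x ^ v := by
  rcases eq_or_ne x 1 with rfl | hx1
  · simp [spechtRatio]
  have hlog : Real.log x ≠ 0 := Real.log_ne_zero_of_pos_of_ne_one hx hx1
  have hsub : x - 1 ≠ 0 := sub_ne_zero.2 hx1
  -- With this logarithmic mean, `S(x) = c e^{1/c - 1}`, and the claim becomes `y + 1 ≤ e^y` at `y =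
  -- 1/c + v log x - 1`.
  set c := (x - 1) / Real.log x with hc
  have hc0 : 0 < c := by
    rcases lt_or_gt_of_ne hx1 with h | h
    · exact div_pos_of_neg_of_neg (by linarith) (Real.log_neg hx h)
    · exact div_pos (by linarith) (Real.log_pos h)
  have hcinv : ((1 - v) + v * x) / c = (1 / c + v * Real.log x - 1) + 1 := by
    rw [hc]; field_simp; ring
  calc (1 - v) + v * x = c * (((1 - v) + v * x) / c) := by field_simp
    _ ≤ c * Real.exp (1 / c + v * Real.log x - 1) := by
      rw [hcinv]
      exact mul_le_mul_of_nonneg_left (Real.add_one_le_exp _) hc0.le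
    _ = spechtRatio x * x ^ v := by
      rw [spechtRatio, if_neg hx1, Real.rpow_def_of_pos hx, Real.rpow_def_of_pos hx, Real.exp_sub,
        Real.exp_add, hc, mul_comm v, one_div_div, mul_one_div]
      have := Real.exp_ne_zero 1
      field_simp

theorem one_le_spechtRatio {x : ℝ} (hx : 0 < x) : 1 ≤ spechtRatio x := by
  simpa using arith_mean_le_spechtRatio_mul_rpow hx 0

/-- On an interval the ratio of arithmetic and geometric mean is bounded by the larger of the Specht
ratios of the end points. -/
theorem arith_mean_le_max_spechtRatio_mul_rpow {a b x v : ℝ} (hax : Real.exp a ≤ x)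
    (hxb : x ≤ Real.exp b) (hv : v ∈ Set.Icc (0 : ℝ) 1) :
    (1 - v) + v * x ≤ max (spechtRatio (Real.exp a)) (spechtRatio (Real.exp b)) * x ^ v := by
  have hx : 0 < x := (Real.exp_pos a).trans_le hax
  -- The ratio of the two means at `x = e^u`. It is convex in `u`, hence largest at an end point; no
  -- monotonicity of `S` is needed.
  let f : ℝ → ℝ := fun u => (1 - v) * Real.exp (-v * u) + v * Real.exp ((1 - v) * u)
  have hexp : ∀ m : ℝ, ConvexOn ℝ Set.univ fun u : ℝ => Real.exp (m * u) := fun m =>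
    convexOn_exp.comp_linearMap (LinearMap.mul ℝ ℝ m)
  have hf : ConvexOn ℝ Set.univ f :=
    ((hexp _).smul (sub_nonneg.2 hv.2)).add ((hexp _).smul hv.1)
  have hfe : ∀ u, (1 - v) + v * Real.exp u = f u * Real.exp u ^ v := by
    intro u
    simp only [f, ← Real.exp_mul, add_mul, mul_assoc, ← Real.exp_add]
    ring_nf
    simp only [Real.exp_zero]
    ring
  have hfS : ∀ u, f u ≤ spechtRatio (Real.exp u) := by
    intro u
    have := arith_mean_le_spechtRatio_mul_rpow (Real.exp_pos u) v
    rw [hfe] at this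
    exact le_of_mul_le_mul_right this (by positivity)
  obtain ⟨u, rfl⟩ : ∃ u, Real.exp u = x := ⟨_, Real.exp_log hx⟩
  rw [Real.exp_le_exp] at hax hxb
  rw [hfe]
  gcongr
  exact (hf.le_max_of_mem_Icc (Set.mem_univ a) (Set.mem_univ b) ⟨hax, hxb⟩).trans
    (max_le_max (hfS a) (hfS b))

/-! ### Operator inequalities in C⋆-algebras. -/

section CStar

variable {A : Type*} [CStarAlgebra A] [PartialOrder A] [StarOrderedRing A]

open NormedSpace

theorem isStrictlyPositive_exp {a : A} (ha : IsSelfAdjoint a) : IsStrictlyPositive (exp a) := by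
  let +nondep : NormedAlgebra ℚ A := .restrictScalars ℚ ℝ A
  exact (isUnit_exp a).isStrictlyPositive ha.exp_nonneg

theorem exp_smul_exp_rpow {a : A} (ha : IsSelfAdjoint a) (c p : ℝ) :
    (Real.exp c • exp a) ^ p = Real.exp (c * p) • exp (p • a) := by
  have hpa : IsSelfAdjoint (p • a) := (IsSelfAdjoint.all p).smul ha
  have h1 : Real.exp c • exp a = cfc (fun x => Real.exp (c + x)) a := by
    rw [← CFC.real_exp_eq_normedSpace_exp, ← cfc_smul _ _ _]
    simp [Real.exp_add]
  have h2 : exp (p • a) = cfc (fun x => Real.exp (p * x)) a := by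
    rw [← CFC.real_exp_eq_normedSpace_exp, ← cfc_smul_id (R := ℝ) p a, ← cfc_comp _ _ a]
    rfl
  rw [h1, CFC.cfc_rpow fun x _ => Real.exp_pos _, h2, ← cfc_smul _ _ _]
  refine cfc_congr fun x _ => ?_
  simp only [smul_eq_mul, ← Real.exp_mul, ← Real.exp_add]
  ring_nf

/-- Loewner--Heinz for the Olson order. -/
theorem rpow_le_rpow_of_forall_one_le {a b : A} (h : ∀ r : ℝ, 1 ≤ r → a ^ r ≤ b ^ r)
    (ha : IsStrictlyPositive a) (hb : IsStrictlyPositive b) {p : ℝ} (hp : 0 < p) :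
    a ^ p ≤ b ^ p := by
  rcases le_total 1 p with h1 | h1
  · exact h p h1
  · have := h 1 le_rfl
    rw [CFC.rpow_one a, CFC.rpow_one b] at this
    exact CFC.rpow_le_rpow ⟨hp.le, h1⟩ this

/-- A reverse arithmetic--geometric mean inequality for positive operators. -/
theorem arith_mean_le_max_spechtRatio_smul_geom_mean {a b : A} (ha : IsStrictlyPositive a)
    (hb : IsStrictlyPositive b) {σ τ v : ℝ} (hσ : Real.exp σ • a ≤ b) (hτ : b ≤ Real.exp τ • a)
    (hv : v ∈ Set.Icc (0 : ℝ) 1) :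
    (1 - v) • a + v • b ≤ max (spechtRatio (Real.exp σ)) (spechtRatio (Real.exp τ)) •
      (a ^ (1 / 2 : ℝ) * (a ^ (-(1 / 2) : ℝ) * b * a ^ (-(1 / 2) : ℝ)) ^ v * a ^ (1 / 2 : ℝ)) := by
  set q := a ^ (1 / 2 : ℝ) with hq
  set r := a ^ (-(1 / 2) : ℝ) with hr
  have hq0 : IsSelfAdjoint q := .of_nonneg CFC.rpow_nonneg
  have hr0 : IsSelfAdjoint r := .of_nonneg CFC.rpow_nonneg
  have hqr : q * r = 1 := CFC.rpow_mul_rpow_neg _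
  have hrq : r * q = 1 := CFC.rpow_neg_mul_rpow _
  have hqq : q * q = a := by
    rw [hq, ← CFC.rpow_add ha.isUnit]; norm_num [CFC.rpow_one a]
  have hrar : r * a * r = 1 := by
    rw [← hqq, ← mul_assoc, hrq, one_mul, hqr]
  -- Conjugation by `a^{-1/2}` reduces to the pair `1, c` with spectrum of `c` in `[e^σ, e^τ]`,
  -- where the scalar inequality applies; conjugation by `a^{1/2}` returns.
  set c := r * b * r with hc
  have hqcq : q * c * q = b := by
    rw [hc, ← mul_assoc, ← mul_assoc, hqr, one_mul, mul_assoc, hrq, mul_one]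
  have hc0 : 0 ≤ c := by simpa using hr0.conjugate_le_conjugate hb.nonneg
  have hcσ : algebraMap ℝ A (Real.exp σ) ≤ c := by
    have := hr0.conjugate_le_conjugate hσ
    rwa [mul_smul_comm, smul_mul_assoc, hrar, ← Algebra.algebraMap_eq_smul_one] at this
  have hcτ : c ≤ algebraMap ℝ A (Real.exp τ) := by
    have := hr0.conjugate_le_conjugate hτ
    rwa [mul_smul_comm, smul_mul_assoc, hrar, ← Algebra.algebraMap_eq_smul_one] at this
  have hsa : IsSelfAdjoint c := .of_nonneg hc0
  have hspec : ∀ x ∈ spectrum ℝ c, Real.exp σ ≤ x ∧ x ≤ Real.exp τ := fun x hx =>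
    ⟨(algebraMap_le_iff_le_spectrum hsa).1 hcσ x hx, (le_algebraMap_iff_spectrum_le hsa).1 hcτ x hx⟩
  set M := max (spechtRatio (Real.exp σ)) (spechtRatio (Real.exp τ))
  have hcont : ContinuousOn (fun x : ℝ => x ^ v) (spectrum ℝ c) :=
    ContinuousOn.rpow_const continuousOn_id fun x hx =>
      Or.inl ((Real.exp_pos σ).trans_le (hspec x hx).1).ne'
  have key : algebraMap ℝ A (1 - v) + v • c ≤ M • c ^ v := by
    have h1 : algebraMap ℝ A (1 - v) + v • c = cfc (fun x => (1 - v) + v * x) c := by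
      rw [cfc_const_add _ _ _, cfc_const_mul_id _ _]
    have h2 : M • c ^ v = cfc (fun x => M * x ^ v) c := by
      rw [CFC.rpow_eq_cfc_real, cfc_const_mul _ _ _]
    rw [h1, h2]
    exact cfc_mono fun x hx =>
      arith_mean_le_max_spechtRatio_mul_rpow (hspec x hx).1 (hspec x hx).2 hv
  have := hq0.conjugate_le_conjugate key
  rwa [Algebra.algebraMap_eq_smul_one, mul_add, add_mul, mul_smul_comm, mul_smul_comm,
    mul_smul_comm, smul_mul_assoc, smul_mul_assoc, smul_mul_assoc, mul_one, hqq, hqcq] at this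

/-- The exponent of the log-Euclidean mean is dominated by the logarithm of the rescaled geometric
mean. -/
theorem smul_le_log_max_spechtRatio_smul_geom_mean {h k : A} (hh : IsSelfAdjoint h)
    (hk : IsSelfAdjoint k) {σ τ v p : ℝ} (hσ : Real.exp σ • exp (p • h) ≤ exp (p • k))
    (hτ : exp (p • k) ≤ Real.exp τ • exp (p • h)) (hv : v ∈ Set.Icc (0 : ℝ) 1) :
    IsStrictlyPositive (max (spechtRatio (Real.exp σ)) (spechtRatio (Real.exp τ)) •
      (exp (p • h) ^ (1 / 2 : ℝ) *
        (exp (p • h) ^ (-(1 / 2) : ℝ) * exp (p • k) * exp (p • h) ^ (-(1 / 2) : ℝ)) ^ v *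
        exp (p • h) ^ (1 / 2 : ℝ))) ∧
    p • ((1 - v) • h + v • k) ≤
      CFC.log (max (spechtRatio (Real.exp σ)) (spechtRatio (Real.exp τ)) •
        (exp (p • h) ^ (1 / 2 : ℝ) *
          (exp (p • h) ^ (-(1 / 2) : ℝ) * exp (p • k) * exp (p • h) ^ (-(1 / 2) : ℝ)) ^ v *
          exp (p • h) ^ (1 / 2 : ℝ))) := by
  have hph : IsSelfAdjoint (p • h) := (IsSelfAdjoint.all p).smul hh
  have hpk : IsSelfAdjoint (p • k) := (IsSelfAdjoint.all p).smul hk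
  have ha := isStrictlyPositive_exp hph
  have hb := isStrictlyPositive_exp hpk
  have hv1 : 0 ≤ 1 - v := sub_nonneg.2 hv.2
  have hconc := CFC.concaveOn_log (A := A)
  have hmean : IsStrictlyPositive ((1 - v) • exp (p • h) + v • exp (p • k)) :=
    hconc.1 ha hb hv1 hv.1 (by ring)
  have hle := arith_mean_le_max_spechtRatio_smul_geom_mean ha hb hσ hτ hv
  refine ⟨hmean.of_le hle, ?_⟩
  refine le_trans ?_ (CFC.log_le_log hle hmean)
  have := hconc.2 ha hb hv1 hv.1 (by ring)
  rw [CFC.log_exp _ hph, CFC.log_exp _ hpk] at this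
  rwa [smul_add, smul_comm p, smul_comm p]

end CStar

/-! ### Matrices and the eigenvalue inequality. -/

open Matrix.Norms.L2Operator in
theorem Matrix.IsHermitian.eigenvalues₀_exp {ι : Type*} [Fintype ι] [DecidableEq ι]
    {A : Matrix ι ι ℂ} (hA : A.IsHermitian) (hB : (NormedSpace.exp A).IsHermitian)
    (k : Fin (Fintype.card ι)) : hB.eigenvalues₀ k = Real.exp (hA.eigenvalues₀ k) :=
  hA.eigenvalues₀_eq_of_eq_cfc hB Real.exp_monotone
    (CFC.real_exp_eq_normedSpace_exp (a := A) hA).symm k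

theorem Matrix.IsHermitian.eigenvalues₀_smul {ι : Type*} [Fintype ι] [DecidableEq ι]
    {A : Matrix ι ι ℂ} (hA : A.IsHermitian) {c : ℝ} (hc : 0 ≤ c) (hB : (c • A).IsHermitian)
    (k : Fin (Fintype.card ι)) : hB.eigenvalues₀ k = c * hA.eigenvalues₀ k :=
  hA.eigenvalues₀_eq_of_eq_cfc hB (monotone_mul_left_of_nonneg hc)
    (cfc_const_mul_id (R := ℝ) c A hA).symm k

-- Two scalars, so that `d = 0` or `c = 0` covers either side of the hypothesis.
open Matrix.Norms.L2Operator in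
theorem rpow_exp_le_of_olsonLE {ι : Type*} [Fintype ι] [DecidableEq ι] {H K : Matrix ι ι ℂ}
    (hH : H.IsHermitian) (hK : K.IsHermitian) {c d p : ℝ} (hp : 0 < p)
    (h : OlsonLE (Real.exp c • NormedSpace.exp H) (Real.exp d • NormedSpace.exp K)) :
    Real.exp (c * p) • NormedSpace.exp (p • H) ≤ Real.exp (d * p) • NormedSpace.exp (p • K) := by
  rw [← exp_smul_exp_rpow (A := Matrix ι ι ℂ) hH, ← exp_smul_exp_rpow (A := Matrix ι ι ℂ) hK]
  exact rpow_le_rpow_of_forall_one_le (A := Matrix ι ι ℂ) h.2.2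
    ((isStrictlyPositive_exp (A := Matrix ι ι ℂ) hH).smul (Real.exp_pos c))
    ((isStrictlyPositive_exp (A := Matrix ι ι ℂ) hK).smul (Real.exp_pos d)) hp

open Matrix.Norms.L2Operator in
/-- The rescaled geometric mean is the exponential of a Hermitian matrix that dominates the exponent
of the log-Euclidean mean. -/
theorem exists_isHermitian_exp_eq_smul_geomMean {ι : Type*} [Fintype ι] [DecidableEq ι]
    {H K : Matrix ι ι ℂ} (hH : H.IsHermitian) (hK : K.IsHermitian) {σ τ v p : ℝ}
    (hσ : Real.exp σ • NormedSpace.exp (p • H) ≤ NormedSpace.exp (p • K))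
    (hτ : NormedSpace.exp (p • K) ≤ Real.exp τ • NormedSpace.exp (p • H))
    (hv : v ∈ Set.Icc (0 : ℝ) 1) :
    ∃ Y : Matrix ι ι ℂ, Y.IsHermitian ∧ p • ((1 - v) • H + v • K) ≤ Y ∧
      NormedSpace.exp Y = max (spechtRatio (Real.exp σ)) (spechtRatio (Real.exp τ)) •
        geomMean v (NormedSpace.exp (p • H)) (NormedSpace.exp (p • K)) := by
  obtain ⟨hpos, hle⟩ :=
    smul_le_log_max_spechtRatio_smul_geom_mean (A := Matrix ι ι ℂ) hH hK hσ hτ hv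
  exact ⟨_, IsSelfAdjoint.log, hle, CFC.exp_log _ hpos⟩

/-- `eigenvalues₀` lists the eigenvalues of a Hermitian matrix, with multiplicity, in decreasing
order. -/
theorem theorem2p4 {ι : Type*} [Fintype ι] [DecidableEq ι] (H K : Matrix ι ι ℂ)
    (hH : H.IsHermitian) (hK : K.IsHermitian) (s t : ℝ) (hst : s ≤ t)
    (hs : OlsonLE (Real.exp s • NormedSpace.exp H) (NormedSpace.exp K))
    (ht : OlsonLE (NormedSpace.exp K) (Real.exp t • NormedSpace.exp H))
    (α : ℝ) (hα : α ∈ Set.Icc (0 : ℝ) 1) (p : ℝ) (hp : 0 < p) (k : Fin (Fintype.card ι)) :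
    (isHermitian_exp_add hH hK α).eigenvalues₀ k ≤
      (max (spechtRatio (Real.exp (s * p))) (spechtRatio (Real.exp (t * p)))) ^ (1 / p) *
        (isHermitian_geomMean α (NormedSpace.exp (p • H))
          (NormedSpace.exp (p • K))).eigenvalues₀ k ^ (1 / p) := by
  have hs' := rpow_exp_le_of_olsonLE hH hK (c := s) (d := 0) hp (by simpa using hs)
  have ht' := rpow_exp_le_of_olsonLE hK hH (c := 0) (d := t) hp (by simpa using ht)
  simp only [zero_mul, Real.exp_zero, one_smul] at hs' ht'
  obtain ⟨Y, hY, hle, hexp⟩ := exists_isHermitian_exp_eq_smul_geomMean hH hK hs' ht' hα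
  set M := max (spechtRatio (Real.exp (s * p))) (spechtRatio (Real.exp (t * p)))
  have hM : 0 < M :=
    lt_max_of_lt_left (zero_lt_one.trans_le (one_le_spechtRatio (Real.exp_pos _)))
  have hL : ((1 - α) • H + α • K).IsHermitian :=
    (hH.smul (IsSelfAdjoint.all _)).add (hK.smul (IsSelfAdjoint.all _))
  have hpL : (p • ((1 - α) • H + α • K)).IsHermitian := hL.smul (IsSelfAdjoint.all _)
  have hG := isHermitian_geomMean α (NormedSpace.exp (p • H)) (NormedSpace.exp (p • K))
  have hMG : (M • geomMean α (NormedSpace.exp (p • H)) (NormedSpace.exp (p • K))).IsHermitian :=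
    hG.smul (IsSelfAdjoint.all _)
  have hYG : M * hG.eigenvalues₀ k = Real.exp (hY.eigenvalues₀ k) := by
    rw [← hG.eigenvalues₀_smul hM.le hMG, ← hY.eigenvalues₀_exp hY.exp]
    congr! 1
    exact hexp.symm
  have hweyl := hpL.eigenvalues₀_le_eigenvalues₀ hY hle k
  rw [hL.eigenvalues₀_smul hp.le hpL] at hweyl
  -- Needed to merge the two `1 / p` powers into one power of `M * λ_k(G) = e^{λ_k(Y)}`.
  have hG0 : 0 ≤ hG.eigenvalues₀ k := by
    have : 0 < M * hG.eigenvalues₀ k := hYG ▸ Real.exp_pos _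
    exact (pos_of_mul_pos_right this hM.le).le
  rw [← Real.mul_rpow hM.le hG0, hYG, ← Real.exp_mul, hL.eigenvalues₀_exp, Real.exp_le_exp,
    mul_one_div, le_div_iff₀ hp, mul_comm]
  exact hweyl
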